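/- **Setting.** Let $d\ge 2$ and let $T$ be an infinite tree all of whose nodes have degree $d$. Nodes are anonymous; at each node the incident edges carry the port numbers $0,1,\dots,d-1$ in an arbitrary way. Let $z(r)=1+\sum_{k=0}^{r-1} d(d-1)^k$ be the number of nodes at distance at most $r$ from any given node, and let $a(r)=2(z(r)-1)$. An agent has a label $\ell\ge 1$ and starts at some node $v$. Agents move in synchronous rounds: in each round an agent stays idle or leaves its current node by a port it chooses, and on entering a node it learns the port of entry and the degree of the node. An agent that has not yet been woken up stays at its starting node. **Algorithm URT**, for an agent with label $\ell$ starting at $v$. Let $(b_1,\dots,b_k)$ be the sequence obtained from the binary representation of $\ell$ by replacing every bit $1$ by $010101$ and every bit $0$ by $101010$. Let $r_i=2^{2i}$ if $d=2$ and $r_i=2i$ if $d>2$. For $i=0,1,2,\dots$ and, within each $i$, for $j=1,\dots,k$: if $b_j=1$, explore the ball of radius $r_i$ centered at $v$ twice by depth-first search, taking ports in increasing order at each node and each time starting and finishing at $v$ (each exploration takes $a(r_i)$ rounds, one edge per round); if $b_j=0$, stay at $v$ for $2a(r_i)$ rounds. (The algorithm uses only $\ell$, $d$ and the port numbers perceived.)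 **Theorem.** For every $d\ge 2$ there is a constant $C$, depending only on $d$, such that the following holds for every $d$-regular infinite tree $T$ with arbitrary port numbers. Let two agents with different labels from $\{1,\dots,L\}$ start at nodes of $T$ at distance $D$ from each other, be woken up in arbitrary rounds (so with an arbitrary delay between them), and each execute Algorithm URT from its own wakeup. Then the agents meet, i.e. they are at the same node at the end of the same round, and the number of rounds from the wakeup of the earlier agent until the first meeting is at most $C\, z(D)\log L$. In particular the agents, which know neither $D$ nor $L$, meet in time $O(z(D)\log L)$. -/

import Mathlib

universe u

/-- A port labeling: at every node `v` the edges incident to `v` are numbered, in an arbitrary way,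
by `0, 1, …, deg v - 1`. -/
structure PortLabeling {V : Type u} (G : SimpleGraph V) [G.LocallyFinite] where
  port : ∀ v : V, G.neighborSet v ≃ Fin (G.degree v)

/-- The behaviour of an agent over finitely many rounds. In each round the agent either stays
idle or leaves its current node by a port of its choice. After a move it learns the port by which
it entered the new node and the degree of that node, and its further behaviour may depend on
these two numbers (and on nothing else). `done` is the behaviour that takes no rounds. -/
inductive Prog : Type where
  | done : Prog
  | idle (next : Prog) : Prog
  | move (port : ℕ) (next : (entryPort degree : ℕ) → Prog) : Prog

namespace Prog

/-- Execute the first behaviour, then the second. -/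
def seq : Prog → Prog → Prog
  | done, Q => Q
  | idle P, Q => idle (P.seq Q)
  | move p k, Q => move p fun e c => (k e c).seq Q

/-- Execute the behaviours of a list one after another. -/
def seqList : List Prog → Prog
  | [] => done
  | P :: Ps => P.seq (seqList Ps)

/-- Stay idle for `t` rounds. -/
def pass : ℕ → Prog
  | 0 => done
  | t + 1 => idle (pass t)

/-- Depth-first exploration, to depth `r`, of the part of a tree hanging from the current node:
`c` is the degree of the current node and `entry` is the port leading back to the parent
(`none` at the starting node). All other ports are taken in increasing order; through each of
them the agent visits the child, explores there to depth `r - 1`, and comes back through the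
port by which it entered the child. -/
def dfs : (r c : ℕ) → (entry : Option ℕ) → Prog
  | 0, _, _ => done
  | r + 1, c, entry =>
      seqList (((List.range c).filter fun p => entry ≠ some p).map fun p =>
        move p fun e c' => (dfs r c' (some e)).seq (move e fun _ _ => done))

/-- Procedure `ACT`: depth-first exploration of the ball of radius `r` centered at the current
node, which has degree `d`, in increasing order of port numbers. -/
def act (d r : ℕ) : Prog := dfs r d none

end Prog

namespace URT

/-- The number `z(r)` of nodes of a ball of radius `r` in the infinite `d`-regular tree, as an
agent computes it from `d`: one center and `d (d - 1) ^ k` nodes at distance `k + 1`. -/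
def z (d r : ℕ) : ℕ := 1 + ∑ k ∈ Finset.range r, d * (d - 1) ^ k

/-- The number of edge traversals of a depth-first exploration of a ball of radius `r`. -/
def a (d r : ℕ) : ℕ := 2 * (z d r - 1)

/-- The radius of the balls explored in stage `i`. -/
def radius (d i : ℕ) : ℕ := if d = 2 then 2 ^ (2 * i) else 2 * i

/-- The transformed label: every bit `1` of the binary representation of `l` (most significant
bit first) is replaced by `010101`, every bit `0` by `101010`. -/
def trans (l : ℕ) : List Bool :=
  l.bits.reverse.flatMap fun b =>
    if b then [false, true, false, true, false, true]
    else [true, false, true, false, true, false]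

/-- Procedure `Exec(d, b, i)`. -/
def exec (d : ℕ) (b : Bool) (i : ℕ) : Prog :=
  if b then (Prog.act d (radius d i)).seq (Prog.act d (radius d i))
  else Prog.pass (2 * a d (radius d i))

/-- Stage `i` of Algorithm URT for an agent with label `l` in a tree of degree `d`. -/
def stage (l d i : ℕ) : Prog := Prog.seqList ((trans l).map fun b => exec d b i)

/-- Stages `0, 1, …, n - 1` of Algorithm URT for an agent with label `l` in a tree of
degree `d`. -/
def stages (l d n : ℕ) : Prog := Prog.seqList ((List.range n).map fun i => stage l d i)

end URT

namespace PortLabeling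

variable {V : Type u} {G : SimpleGraph V} [G.LocallyFinite]

/-- The node reached from `v` through port `p`, together with the port of entry there.
A port number that does not exist at `v` leaves the agent at `v`. -/
def cross (P : PortLabeling G) (v : V) (p : ℕ) : V × ℕ :=
  if h : p < G.degree v then
    let w : G.neighborSet v := (P.port v).symm ⟨p, h⟩
    (w.1, (P.port w.1 ⟨v, w.2.symm⟩ : ℕ))
  else (v, p)

/-- The nodes occupied after rounds `1, 2, …` by an agent that starts at the given node and
executes the given behaviour. -/
def run (P : PortLabeling G) : Prog → V → List V
  | .done, _ => []
  | .idle Q, v => v :: P.run Q v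
  | .move p k, v =>
      (P.cross v p).1 :: P.run (k (P.cross v p).2 (G.degree (P.cross v p).1)) (P.cross v p).1

/-- The node occupied `t` rounds after its wakeup by an agent with label `l` that starts at `v`
and executes Algorithm URT. Every stage except possibly stage `0` takes at least one round when
all degrees are at least `2` and `l ≥ 1`, so that stages `0, …, t` last for at least `t` rounds,
and the later stages do not matter for the position after `t` rounds. -/
def urtPos (P : PortLabeling G) (l : ℕ) (v : V) (t : ℕ) : V :=
  (v :: P.run (URT.stages l (G.degree v) (t + 1)) v).getD t v

/-- The node occupied at round `t` (of a global clock) by an agent with label `l` that starts at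
`v` and is woken up in round `w`. Before round `w` it stays at `v`: the subtraction is truncated. -/
def urtPosAt (P : PortLabeling G) (l : ℕ) (v : V) (w t : ℕ) : V :=
  P.urtPos l v (t - w)

/-- The two agents, with labels `l₁`, `l₂`, starting nodes `v₁`, `v₂` and wakeup rounds
`w₁`, `w₂`, are at the same node `τ` rounds after the wakeup of the earlier agent. -/
def TogetherAt (P : PortLabeling G) (l₁ l₂ : ℕ) (v₁ v₂ : V) (w₁ w₂ τ : ℕ) : Prop :=
  P.urtPosAt l₁ v₁ w₁ (min w₁ w₂ + τ) = P.urtPosAt l₂ v₂ w₂ (min w₁ w₂ + τ)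

end PortLabeling

/-- The number of nodes at distance at most `r` from `x`. -/
noncomputable def ballSize {V : Type u} (G : SimpleGraph V) (x : V) (r : ℕ) : ℕ :=
  {y : V | G.dist x y ≤ r}.ncard

/-- In a tree, a node other than the root has exactly one neighbor closer to the root. -/
theorem existsUnique_parent {V : Type u} {G : SimpleGraph V} (hG : G.IsTree) (x y : V) (k : ℕ)
    (hy : G.dist x y = k + 1) : ∃! w, G.Adj w y ∧ G.dist x w = k := by
  classical
  obtain ⟨p, hp, hl⟩ := hG.connected.exists_path_of_dist x y
  have hnn : ¬ p.Nil := by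
    intro h
    have := SimpleGraph.Walk.length_eq_zero_iff.mpr h
    omega
  have hpl : p.dropLast.length + 1 = p.length := by
    simp; omega
  have hadj := p.adj_penultimate hnn
  refine ⟨p.penultimate, ⟨hadj, ?_⟩, ?_⟩
  · have h1 := SimpleGraph.dist_le p.dropLast
    have h2 := hG.dist_eq_dist_add_one_of_adj x hadj
    omega
  · rintro w ⟨hw, hwd⟩
    obtain ⟨q, hq, hql⟩ := hG.connected.exists_path_of_dist x w
    have hyq : y ∉ q.support := by
      intro hmem
      have h3 := SimpleGraph.dist_le (q.takeUntil y hmem)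
      have h4 := q.length_takeUntil_le_length hmem
      omega
    have hpath : (q.concat hw).IsPath := hq.concat hyq hw
    have := (hG.existsUnique_path x y).unique hp hpath
    rw [this]; simp

/-- The formula by which agents compute `z(r)` is the size of every ball of radius `r`. -/
theorem ballSize_eq_z {V : Type u} {G : SimpleGraph V} [G.LocallyFinite] (hG : G.IsTree) {d : ℕ}
    (hd : G.IsRegularOfDegree d) (x : V) (r : ℕ) : ballSize G x r = URT.z d r := by
  classical
  have sphere : ∀ k, ∃ s : Finset V, (∀ y, y ∈ s ↔ G.dist x y = k + 1) ∧
      s.card = d * (d - 1) ^ k := by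
    intro k
    induction k with
    | zero =>
      refine ⟨G.neighborFinset x, fun y => ?_, ?_⟩
      · simp [SimpleGraph.dist_eq_one_iff_adj]
      · simpa using hd x
    | succ k ih =>
      obtain ⟨s, hs, hc⟩ := ih
      refine ⟨s.biUnion fun w => (G.neighborFinset w).filter fun y => G.dist x y = k + 2,
        fun y => ?_, ?_⟩
      · simp only [Finset.mem_biUnion, Finset.mem_filter, SimpleGraph.mem_neighborFinset, hs]
        constructor
        · rintro ⟨w, _, _, h⟩; exact h
        · intro h
          obtain ⟨w, ⟨hw, hwd⟩, _⟩ := existsUnique_parent hG x y (k + 1) h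
          exact ⟨w, hwd, hw, h⟩
      · rw [Finset.card_biUnion]
        · rw [Finset.sum_const_nat (m := d - 1), hc, pow_succ, mul_assoc]
          intro w hw
          rw [hs] at hw
          obtain ⟨u, ⟨hu, hud⟩, huniq⟩ := existsUnique_parent hG x w k hw
          have : (G.neighborFinset w).filter (fun y => G.dist x y = k + 2)
              = (G.neighborFinset w).erase u := by
            ext y
            simp only [Finset.mem_filter, Finset.mem_erase, SimpleGraph.mem_neighborFinset]
            constructor
            · rintro ⟨h1, h2⟩
              refine ⟨?_, h1⟩
              rintro rfl; omega
            · rintro ⟨h1, h2⟩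
              refine ⟨h2, ?_⟩
              have h3 := hG.dist_eq_dist_add_one_of_adj x h2
              have h4 : G.dist x y ≠ k := fun h => h1 (huniq y ⟨h2.symm, h⟩)
              omega
          rw [this, Finset.card_erase_of_mem (by simpa using hu.symm),
            SimpleGraph.card_neighborFinset_eq_degree, hd w]
        · intro w hw w' hw' hne
          rw [Function.onFun, Finset.disjoint_left]
          intro y hy hy'
          simp only [Finset.mem_filter, SimpleGraph.mem_neighborFinset, hs, Finset.mem_coe] at *
          exact hne ((existsUnique_parent hG x y (k + 1) hy.2).unique ⟨hy.1, hw⟩ ⟨hy'.1, hw'⟩)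
  have ball : ∃ s : Finset V, (∀ y, y ∈ s ↔ G.dist x y ≤ r) ∧ s.card = URT.z d r := by
    induction r with
    | zero =>
      refine ⟨{x}, fun y => ?_, by simp [URT.z]⟩
      simp [hG.connected.dist_eq_zero_iff, eq_comm]
    | succ r ih =>
      obtain ⟨s, hs, hc⟩ := ih
      obtain ⟨t, ht, hct⟩ := sphere r
      refine ⟨s ∪ t, fun y => ?_, ?_⟩
      · rw [Finset.mem_union, hs, ht]; omega
      · rw [Finset.card_union_of_disjoint, hc, hct, URT.z, URT.z, Finset.sum_range_succ]
        · ring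
        · rw [Finset.disjoint_left]
          intro y hy hy'
          rw [hs] at hy; rw [ht] at hy'; omega
  obtain ⟨s, hs, hc⟩ := ball
  rw [ballSize, ← hc, ← Set.ncard_coe_finset]
  congr 1
  ext y
  simp [hs]

theorem le_length_run_seq_left {V : Type u} {G : SimpleGraph V} [G.LocallyFinite]
    (P : PortLabeling G) (A B : Prog) (v : V) :
    (P.run A v).length ≤ (P.run (A.seq B) v).length := by
  induction A generalizing v with
  | done => simp [PortLabeling.run]
  | idle A ih => simpa [Prog.seq, PortLabeling.run] using ih v
  | move p k ih => simpa [Prog.seq, PortLabeling.run] using ih _ _ _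

theorem le_length_run_seq {V : Type u} {G : SimpleGraph V} [G.LocallyFinite]
    (P : PortLabeling G) {m n : ℕ} (A B : Prog) (hA : ∀ v, m ≤ (P.run A v).length)
    (hB : ∀ v, n ≤ (P.run B v).length) (v : V) : m + n ≤ (P.run (A.seq B) v).length := by
  have key : ∀ v, (P.run A v).length + n ≤ (P.run (A.seq B) v).length := by
    clear hA
    intro v
    induction A generalizing v with
    | done => simpa [Prog.seq, PortLabeling.run] using hB v
    | idle A ih =>
      have := ih v
      simp only [Prog.seq, PortLabeling.run, List.length_cons]; omega
    | move p k ih =>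
      have := ih (P.cross v p).2 (G.degree (P.cross v p).1) (P.cross v p).1
      simp only [Prog.seq, PortLabeling.run, List.length_cons]; omega
  have := hA v
  have := key v
  omega

theorem le_length_run_seqList {V : Type u} {G : SimpleGraph V} [G.LocallyFinite]
    (P : PortLabeling G) {m : ℕ} (As : List Prog) (A : Prog) (hA : A ∈ As)
    (hm : ∀ v, m ≤ (P.run A v).length) (v : V) : m ≤ (P.run (Prog.seqList As) v).length := by
  induction As generalizing v with
  | nil => simp at hA
  | cons B Bs ih =>
    rcases List.mem_cons.mp hA with rfl | h
    · exact (hm v).trans (le_length_run_seq_left P _ _ v)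
    · have := le_length_run_seq P B (Prog.seqList Bs) (m := 0) (fun _ => Nat.zero_le _) (ih h) v
      simpa [Prog.seqList] using this

theorem length_run_pass {V : Type u} {G : SimpleGraph V} [G.LocallyFinite]
    (P : PortLabeling G) (t : ℕ) (v : V) : (P.run (Prog.pass t) v).length = t := by
  induction t with
  | zero => rfl
  | succ t ih => simpa [Prog.pass, PortLabeling.run] using ih

/-- Stages `0, …, t` of Algorithm URT last for at least `t` rounds. -/
theorem le_length_run_stages {V : Type u} {G : SimpleGraph V} [G.LocallyFinite]
    (P : PortLabeling G) {l d : ℕ} (hl : 1 ≤ l) (hd : 2 ≤ d) (t : ℕ) (v : V) :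
    t ≤ (P.run (URT.stages l d (t + 1)) v).length := by
  have hmem : false ∈ URT.trans l := by
    have hb : l.bits ≠ [] := by
      intro h
      have := congrArg List.length h
      rw [Nat.size_eq_bits_len] at this
      have := Nat.size_eq_zero.mp this
      omega
    obtain ⟨b, hb⟩ := List.exists_mem_of_ne_nil _ hb
    rw [URT.trans, List.mem_flatMap]
    exact ⟨b, by simpa using hb, by cases b <;> simp⟩
  have hstage : ∀ i, 1 ≤ i → ∀ v, 1 ≤ (P.run (URT.stage l d i) v).length := by
    intro i hi
    refine le_length_run_seqList P _ (URT.exec d false i) (List.mem_map_of_mem hmem) fun v => ?_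
    have hr : 1 ≤ URT.radius d i := by
      unfold URT.radius
      split_ifs
      · exact Nat.one_le_two_pow
      · omega
    have hz : d * (d - 1) ^ 0 ≤ ∑ k ∈ Finset.range (URT.radius d i), d * (d - 1) ^ k :=
      Finset.single_le_sum (f := fun k => d * (d - 1) ^ k) (fun _ _ => Nat.zero_le _)
        (Finset.mem_range.mpr hr)
    simp only [URT.exec, Bool.false_eq_true, if_false, length_run_pass, URT.a, URT.z]
    simp only [pow_zero, mul_one] at hz
    omega
  have aux : ∀ (is : List ℕ), (∀ i ∈ is, 1 ≤ i) → ∀ v,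
      is.length ≤ (P.run (Prog.seqList (is.map fun i => URT.stage l d i)) v).length := by
    intro is
    induction is with
    | nil => simp
    | cons i is ih =>
      intro h v
      have := le_length_run_seq P _ _ (hstage i (h i (by simp)))
        (ih fun j hj => h j (by simp [hj])) v
      simpa [Prog.seqList, add_comm] using this
  rw [URT.stages, List.range_succ_eq_map, List.map_cons, Prog.seqList]
  have := le_length_run_seq P (URT.stage l d 0) _ (m := 0) (fun _ => Nat.zero_le _)
    (aux ((List.range t).map Nat.succ) (by simp)) v
  simpa using this

/-!
An agent that is asleep or waits at home during a `0`-block is found by the other one as soon as the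
latter explores a large enough ball. Transformed labels start with `0` and consist of the pairs `01`
and `10`, so an agent explores at least once in every pair of blocks, and the blocks of a stage are
at least four times as long as those of the stage before.

Suppose that both agents already explore large enough balls. If one of them enters a stage clearly
before the other, it sits in the long first `0`-block of this stage while the other one, in its old
stage, completes a pair of blocks. Otherwise the two start the stage almost simultaneously. If their
words differ at some position, then in that block one of them waits while the other one explores
twice, and the shift is too short to spoil both explorations. If there is no such position, the
words have different lengths, so that one agent finishes the stage clearly before the other.

The exploration time grows at most by the factor `d ^ 2` per stage, so the agents meet within a
constant number of stages whose blocks have length `O(z(D))`, and the words have length `O(log L)`.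
-/

namespace Prog

theorem seq_assoc (A B C : Prog) : (A.seq B).seq C = A.seq (B.seq C) := by
  induction A with
  | done => rfl
  | idle A ih => rw [seq, seq, seq, ih]
  | move p k ih =>
    simp only [seq]
    exact congrArg (move p) (funext₂ ih)

theorem seqList_append (As Bs : List Prog) :
    seqList (As ++ Bs) = (seqList As).seq (seqList Bs) := by
  induction As with
  | nil => rfl
  | cons A As ih => rw [List.cons_append, seqList, seqList, ih, seq_assoc]

/-- The ports, in increasing order, through which a depth-first exploration leaves a node of degree
`d` that it entered through the port `entry` (`none` at the starting node). -/
def childPorts (d : ℕ) (entry : Option ℕ) : List ℕ :=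
  (List.range d).filter fun p => entry ≠ some p

theorem mem_childPorts {d p : ℕ} {entry : Option ℕ} :
    p ∈ childPorts d entry ↔ p < d ∧ entry ≠ some p := by
  simp [childPorts]

theorem length_childPorts_none (d : ℕ) : (childPorts d none).length = d := by
  simp [childPorts]

theorem length_childPorts_some {d e : ℕ} (he : e < d) :
    (childPorts d (some e)).length = d - 1 := by
  have h : childPorts d (some e) = (List.range d).erase e := by
    rw [List.nodup_range.erase_eq_filter, childPorts]
    exact List.filter_congr fun p _ => by by_cases hp : p = e <;> simp [hp, Ne.symm]
  rw [h, List.length_erase_of_mem (List.mem_range.2 he), List.length_range]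

/-- The part of a depth-first exploration that goes through port `p`: visit the child, explore to
depth `r` there, and come back. -/
def visit (r p : ℕ) : Prog :=
  move p fun e c => (dfs r c (some e)).seq (move e fun _ _ => done)

/-- The number of rounds that a depth-first exploration to depth `r` of a `d`-regular tree spends on
each of the ports it takes at its starting node: each of the `(d - 1) ^ k` edges at distance `k`
behind the port is traversed twice. -/
def branchLength (d r : ℕ) : ℕ := 2 * ∑ k ∈ Finset.range r, (d - 1) ^ k

theorem branchLength_succ (d r : ℕ) :
    branchLength d (r + 1) = (d - 1) * branchLength d r + 2 := by
  rw [branchLength, geom_sum_succ, branchLength]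
  ring

theorem dfs_succ (r d : ℕ) (entry : Option ℕ) :
    dfs (r + 1) d entry = seqList ((childPorts d entry).map (visit r)) := rfl

end Prog

namespace URT

theorem a_eq_mul_branchLength (d r : ℕ) : a d r = d * Prog.branchLength d r := by
  rw [a, z, Nat.add_sub_cancel_left, ← Finset.mul_sum, Prog.branchLength]
  ring

/-- The number of rounds of one exploration in stage `n`. For each symbol of its word, an agent
explores twice or waits as long: it spends a block of `2 * halfBlock d n` rounds. -/
def halfBlock (d n : ℕ) : ℕ := a d (radius d n)

/-- The number of rounds that an agent with label `l` spends on stages `0, …, n - 1`. -/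
def stageStart (l d n : ℕ) : ℕ := 2 * (trans l).length * ∑ m ∈ Finset.range n, halfBlock d m

theorem stageStart_succ (l d n : ℕ) :
    stageStart l d (n + 1) = stageStart l d n + 2 * (trans l).length * halfBlock d n := by
  rw [stageStart, Finset.sum_range_succ, mul_add, stageStart]

end URT

namespace PortLabeling

variable {V : Type u} {G : SimpleGraph V} [G.LocallyFinite]

/-- The node occupied after `t` rounds by an agent that executes the given behaviour from the given
node and stays where it is once the behaviour is over. -/
def posAfter (P : PortLabeling G) : Prog → V → ℕ → V
  | .done, v, _ => v
  | .idle _, v, 0 => v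
  | .idle Q, v, t + 1 => P.posAfter Q v t
  | .move _ _, v, 0 => v
  | .move p k, v, t + 1 =>
      P.posAfter (k (P.cross v p).2 (G.degree (P.cross v p).1)) (P.cross v p).1 t

@[simp]
theorem posAfter_zero (P : PortLabeling G) (Q : Prog) (v : V) : P.posAfter Q v 0 = v := by
  cases Q <;> rfl

theorem getD_cons_run (P : PortLabeling G) (Q : Prog) (v x : V) {t : ℕ}
    (ht : t ≤ (P.run Q v).length) : (v :: P.run Q v).getD t x = P.posAfter Q v t := by
  induction Q generalizing v t with
  | done =>
    obtain rfl : t = 0 := by simpa [run] using ht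
    rfl
  | idle Q ih =>
    cases t with
    | zero => rfl
    | succ t => exact ih v (by simpa [run] using ht)
  | move p k ih =>
    cases t with
    | zero => rfl
    | succ t => exact ih _ _ _ (by simpa [run] using ht)

theorem length_run_seq (P : PortLabeling G) (A B : Prog) (v : V) :
    (P.run (A.seq B) v).length = (P.run A v).length +
      (P.run B (P.posAfter A v (P.run A v).length)).length := by
  induction A generalizing v with
  | done => simp [Prog.seq, run, posAfter]
  | idle A ih =>
    simp only [Prog.seq, run, List.length_cons, posAfter, ih]
    omega
  | move p k ih =>
    simp only [Prog.seq, run, List.length_cons, posAfter, ih]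
    omega

theorem posAfter_seq_of_le (P : PortLabeling G) (A B : Prog) (v : V) {t : ℕ}
    (ht : t ≤ (P.run A v).length) : P.posAfter (A.seq B) v t = P.posAfter A v t := by
  induction A generalizing v t with
  | done =>
    obtain rfl : t = 0 := by simpa [run] using ht
    rw [posAfter_zero, posAfter_zero]
  | idle A ih =>
    cases t with
    | zero => rfl
    | succ t => exact ih v (by simpa [run] using ht)
  | move p k ih =>
    cases t with
    | zero => rfl
    | succ t => exact ih _ _ _ (by simpa [run] using ht)

theorem posAfter_seq_add (P : PortLabeling G) (A B : Prog) (v : V) (t : ℕ) :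
    P.posAfter (A.seq B) v ((P.run A v).length + t) =
      P.posAfter B (P.posAfter A v (P.run A v).length) t := by
  induction A generalizing v with
  | done => simp [Prog.seq, run, posAfter]
  | idle A ih =>
    rw [run, List.length_cons, Nat.succ_add]
    exact ih v
  | move p k ih =>
    rw [run, List.length_cons, Nat.succ_add]
    exact ih _ _ _

@[simp]
theorem posAfter_pass (P : PortLabeling G) (n : ℕ) (v : V) (t : ℕ) :
    P.posAfter (Prog.pass n) v t = v := by
  induction n generalizing t with
  | zero => rfl
  | succ n ih =>
    cases t with
    | zero => rfl
    | succ t => exact ih t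

/-- Executed from `v`, the behaviour `Q` takes `n` rounds and ends at `v`. -/
structure IsLoop (P : PortLabeling G) (Q : Prog) (v : V) (n : ℕ) : Prop where
  length_run : (P.run Q v).length = n
  posAfter_eq : P.posAfter Q v n = v

namespace IsLoop

variable {P : PortLabeling G} {A B : Prog} {v : V} {m n : ℕ}

theorem done : P.IsLoop .done v 0 := ⟨rfl, rfl⟩

theorem pass : P.IsLoop (Prog.pass n) v n := ⟨length_run_pass P n v, P.posAfter_pass n v n⟩

theorem posAfter_seq_of_le (hA : P.IsLoop A v m) {t : ℕ} (ht : t ≤ m) :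
    P.posAfter (A.seq B) v t = P.posAfter A v t :=
  P.posAfter_seq_of_le A B v (ht.trans_eq hA.length_run.symm)

theorem posAfter_seq_add (hA : P.IsLoop A v m) (t : ℕ) :
    P.posAfter (A.seq B) v (m + t) = P.posAfter B v t := by
  have h := P.posAfter_seq_add A B v t
  rwa [hA.length_run, hA.posAfter_eq] at h

theorem seq (hA : P.IsLoop A v m) (hB : P.IsLoop B v n) : P.IsLoop (A.seq B) v (m + n) where
  length_run := by
    rw [PortLabeling.length_run_seq, hA.length_run, hA.posAfter_eq, hB.length_run]
  posAfter_eq := by rw [hA.posAfter_seq_add, hB.posAfter_eq]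

variable {ι : Type*} {f : ι → Prog} {c : ι → ℕ} {Qs : List ι}

theorem seqList (h : ∀ q ∈ Qs, P.IsLoop (f q) v (c q)) :
    P.IsLoop (Prog.seqList (Qs.map f)) v (Qs.map c).sum := by
  induction Qs with
  | nil => exact done
  | cons q Qs ih =>
    rw [List.forall_mem_cons] at h
    rw [List.map_cons, List.map_cons, List.sum_cons]
    exact h.1.seq (ih h.2)

theorem posAfter_seqList (h : ∀ q ∈ Qs, P.IsLoop (f q) v (c q)) {j : ℕ} {q : ι}
    (hq : Qs[j]? = some q) {t : ℕ} (ht : t ≤ c q) :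
    P.posAfter (Prog.seqList (Qs.map f)) v (((Qs.take j).map c).sum + t) =
      P.posAfter (f q) v t := by
  induction Qs generalizing j with
  | nil => simp at hq
  | cons q' Qs ih =>
    rw [List.forall_mem_cons] at h
    rw [List.map_cons, Prog.seqList]
    cases j with
    | zero =>
      obtain rfl : q' = q := by simpa using hq
      simpa using h.1.posAfter_seq_of_le ht
    | succ j =>
      rw [List.take_succ_cons, List.map_cons, List.sum_cons, add_assoc, h.1.posAfter_seq_add]
      exact ih h.2 (by simpa using hq)

theorem exists_posAfter_seqList (h : ∀ q ∈ Qs, P.IsLoop (f q) v (c q)) {q : ι} (hq : q ∈ Qs)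
    {u : V} (hu : ∃ t ≤ c q, P.posAfter (f q) v t = u) :
    ∃ t ≤ (Qs.map c).sum, P.posAfter (Prog.seqList (Qs.map f)) v t = u := by
  obtain ⟨t, ht, rfl⟩ := hu
  obtain ⟨j, hj⟩ := List.mem_iff_getElem?.1 hq
  refine ⟨_, ?_, posAfter_seqList h hj ht⟩
  obtain ⟨hlt, rfl⟩ := List.getElem?_eq_some_iff.1 hj
  calc ((Qs.take j).map c).sum + t ≤ ((Qs.take j).map c).sum + ((Qs.drop j).map c).sum := by
        rw [List.drop_eq_getElem_cons hlt, List.map_cons, List.sum_cons]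
        omega
    _ = (Qs.map c).sum := by rw [← List.sum_append, ← List.map_append, List.take_append_drop]

end IsLoop

/-! ### Depth-first exploration -/

theorem cross_port (P : PortLabeling G) {v w : V} (h : G.Adj v w) :
    P.cross v (P.port v ⟨w, h⟩) = (w, (P.port w ⟨v, h.symm⟩ : ℕ)) := by
  have h_entry : ∀ x : G.neighborSet v, x = ⟨w, h⟩ →
      (x.1, (P.port x.1 ⟨v, x.2.symm⟩ : ℕ)) = (w, (P.port w ⟨v, h.symm⟩ : ℕ)) := by
    rintro _ rfl
    rfl
  rw [cross, dif_pos (P.port v ⟨w, h⟩).2]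
  exact h_entry _ ((P.port v).symm_apply_apply ⟨w, h⟩)

theorem exists_adj_port_eq (P : PortLabeling G) {v : V} {p : ℕ} (hp : p < G.degree v) :
    ∃ (w : V) (h : G.Adj v w), (P.port v ⟨w, h⟩ : ℕ) = p :=
  ⟨_, ((P.port v).symm ⟨p, hp⟩).2, by simp⟩

theorem port_lt (P : PortLabeling G) {d : ℕ} (hd : G.IsRegularOfDegree d) {v : V}
    (w : G.neighborSet v) : (P.port v w : ℕ) < d :=
  (P.port v w).2.trans_eq (hd.degree_eq v)

section Visit

variable {P : PortLabeling G} {d r n : ℕ} {v w : V}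

theorem posAfter_visit_succ (hd : G.IsRegularOfDegree d) (h : G.Adj v w)
    (hl : P.IsLoop (Prog.dfs r d (some (P.port w ⟨v, h.symm⟩ : ℕ))) w n) {t : ℕ} (ht : t ≤ n) :
    P.posAfter (Prog.visit r (P.port v ⟨w, h⟩)) v (t + 1) =
      P.posAfter (Prog.dfs r d (some (P.port w ⟨v, h.symm⟩ : ℕ))) w t := by
  rw [Prog.visit, posAfter, P.cross_port h]
  simp only [hd.degree_eq]
  exact hl.posAfter_seq_of_le ht

theorem IsLoop.visit (hd : G.IsRegularOfDegree d) (h : G.Adj v w)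
    (hl : P.IsLoop (Prog.dfs r d (some (P.port w ⟨v, h.symm⟩ : ℕ))) w n) :
    P.IsLoop (Prog.visit r (P.port v ⟨w, h⟩)) v (n + 2) where
  length_run := by
    simp only [Prog.visit, run, P.cross_port h, hd.degree_eq, List.length_cons,
      length_run_seq, hl.length_run, List.length_nil]
  posAfter_eq := by
    rw [Prog.visit, posAfter, P.cross_port h]
    simp only [hd.degree_eq]
    rw [hl.posAfter_seq_add, posAfter, P.cross_port h.symm, posAfter_zero]

theorem isLoop_visit_of_isLoop_dfs (hd : G.IsRegularOfDegree d) {p : ℕ} (hp : p < d)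
    (h : ∀ w, ∀ e < d, P.IsLoop (Prog.dfs r d (some e)) w n) :
    P.IsLoop (Prog.visit r p) v (n + 2) := by
  obtain ⟨w, hw, rfl⟩ := P.exists_adj_port_eq (hp.trans_eq (hd.degree_eq v).symm)
  exact IsLoop.visit hd hw (h w _ (P.port_lt hd _))

end Visit

variable (P : PortLabeling G) {d : ℕ}

theorem isLoop_dfs (hd : G.IsRegularOfDegree d) (r : ℕ) (v : V) (entry : Option ℕ) :
    P.IsLoop (Prog.dfs r d entry) v
      ((Prog.childPorts d entry).length * Prog.branchLength d r) := by
  induction r generalizing v entry with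
  | zero => simpa [Prog.dfs, Prog.branchLength] using IsLoop.done
  | succ r ih =>
    have h_visit : ∀ p ∈ Prog.childPorts d entry,
        P.IsLoop (Prog.visit r p) v (Prog.branchLength d (r + 1)) := fun p hp => by
      rw [Prog.branchLength_succ]
      refine isLoop_visit_of_isLoop_dfs hd (Prog.mem_childPorts.1 hp).1 fun w e he => ?_
      simpa only [Prog.length_childPorts_some he] using ih w (some e)
    simpa [Prog.dfs_succ] using IsLoop.seqList h_visit

theorem isLoop_dfs_some (hd : G.IsRegularOfDegree d) (r : ℕ) (v : V) {e : ℕ} (he : e < d) :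
    P.IsLoop (Prog.dfs r d (some e)) v ((d - 1) * Prog.branchLength d r) := by
  simpa only [Prog.length_childPorts_some he] using P.isLoop_dfs hd r v (some e)

theorem isLoop_visit (hd : G.IsRegularOfDegree d) (r : ℕ) (v : V) {p : ℕ} (hp : p < d) :
    P.IsLoop (Prog.visit r p) v (Prog.branchLength d (r + 1)) := by
  rw [Prog.branchLength_succ]
  exact isLoop_visit_of_isLoop_dfs hd hp fun w _ => P.isLoop_dfs_some hd r w

theorem exists_posAfter_dfs (hd : G.IsRegularOfDegree d) {v u : V} {q : G.Walk v u}
    (hq : q.IsPath) {r : ℕ} (hr : q.length ≤ r) (entry : Option ℕ)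
    (h_entry : ∀ w (h : G.Adj v w), entry = some (P.port v ⟨w, h⟩ : ℕ) → w ∉ q.support) :
    ∃ t ≤ (Prog.childPorts d entry).length * Prog.branchLength d r,
      P.posAfter (Prog.dfs r d entry) v t = u := by
  induction q generalizing r entry with
  | nil => exact ⟨0, Nat.zero_le _, P.posAfter_zero _ _⟩
  | @cons v w u h q ih =>
    cases r with
    | zero => simp at hr
    | succ r =>
      rw [SimpleGraph.Walk.cons_isPath_iff] at hq
      have h_loop := P.isLoop_dfs_some hd r w (P.port_lt hd ⟨v, h.symm⟩)
      have h_back : ∀ x (hx : G.Adj w x),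
          some (P.port w ⟨v, h.symm⟩ : ℕ) = some (P.port w ⟨x, hx⟩ : ℕ) → x ∉ q.support := by
        intro x hx hxv
        obtain rfl : v = x :=
          congrArg Subtype.val ((P.port w).injective (Fin.ext (Option.some.inj hxv)))
        exact hq.2
      obtain ⟨t, ht, htu⟩ := ih hq.1 (Nat.le_of_succ_le_succ hr) _ h_back
      rw [Prog.length_childPorts_some (P.port_lt hd _)] at ht
      have h_mem : (P.port v ⟨w, h⟩ : ℕ) ∈ Prog.childPorts d entry :=
        Prog.mem_childPorts.2 ⟨P.port_lt hd _, fun he => h_entry w h he (by simp)⟩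
      have h_visit : ∃ t ≤ Prog.branchLength d (r + 1),
          P.posAfter (Prog.visit r (P.port v ⟨w, h⟩)) v t = u :=
        ⟨t + 1, by rw [Prog.branchLength_succ]; omega,
          (posAfter_visit_succ hd h h_loop ht).trans htu⟩
      simpa [Prog.dfs_succ] using IsLoop.exists_posAfter_seqList
        (fun p hp => P.isLoop_visit hd r v (Prog.mem_childPorts.1 hp).1) h_mem h_visit

theorem isLoop_act (hd : G.IsRegularOfDegree d) (r : ℕ) (v : V) :
    P.IsLoop (Prog.act d r) v (URT.a d r) := by
  rw [URT.a_eq_mul_branchLength, Prog.act]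
  simpa only [Prog.length_childPorts_none] using P.isLoop_dfs hd r v none

theorem exists_posAfter_act (hG : G.Connected) (hd : G.IsRegularOfDegree d) {r : ℕ} {v u : V}
    (hr : G.dist v u ≤ r) : ∃ t ≤ URT.a d r, P.posAfter (Prog.act d r) v t = u := by
  obtain ⟨q, hq, hl⟩ := hG.exists_path_of_dist v u
  rw [URT.a_eq_mul_branchLength, Prog.act]
  simpa only [Prog.length_childPorts_none] using
    P.exists_posAfter_dfs hd hq (hl.trans_le hr) none (by simp)

/-! ### The timetable of Algorithm URT -/

theorem isLoop_exec (hd : G.IsRegularOfDegree d) (b : Bool) (n : ℕ) (v : V) :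
    P.IsLoop (URT.exec d b n) v (2 * URT.halfBlock d n) := by
  cases b with
  | false => exact IsLoop.pass
  | true =>
    rw [two_mul]
    exact (P.isLoop_act hd _ v).seq (P.isLoop_act hd _ v)

theorem isLoop_stage (hd : G.IsRegularOfDegree d) (l n : ℕ) (v : V) :
    P.IsLoop (URT.stage l d n) v (2 * (URT.trans l).length * URT.halfBlock d n) := by
  have h := IsLoop.seqList (Qs := URT.trans l) fun b _ => P.isLoop_exec hd b n v
  rw [List.map_const', List.sum_replicate, smul_eq_mul] at h
  rwa [mul_right_comm, mul_comm _ (URT.trans l).length]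

theorem isLoop_stages (hd : G.IsRegularOfDegree d) (l n : ℕ) (v : V) :
    P.IsLoop (URT.stages l d n) v (URT.stageStart l d n) := by
  rw [URT.stageStart, Finset.mul_sum]
  exact IsLoop.seqList fun m _ => P.isLoop_stage hd l m v

theorem posAfter_stages_add (l n k : ℕ) (v : V) {t : ℕ}
    (ht : t ≤ (P.run (URT.stages l d n) v).length) :
    P.posAfter (URT.stages l d (n + k)) v t = P.posAfter (URT.stages l d n) v t := by
  rw [URT.stages, List.range_add, List.map_append, Prog.seqList_append]
  exact P.posAfter_seq_of_le _ _ v ht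

theorem urtPos_eq_posAfter_stages (hd : G.IsRegularOfDegree d) (h2 : 2 ≤ d) {l : ℕ} (hl : 1 ≤ l)
    (n : ℕ) (v : V) {t : ℕ} (ht : t ≤ (P.run (URT.stages l d n) v).length) :
    P.urtPos l v t = P.posAfter (URT.stages l d n) v t := by
  have ht' := le_length_run_stages P hl h2 t v
  rw [urtPos, hd.degree_eq, P.getD_cons_run _ _ _ ht', ← P.posAfter_stages_add l (t + 1) n v ht',
    add_comm, P.posAfter_stages_add l n (t + 1) v ht]

theorem urtPos_stageStart_add (hd : G.IsRegularOfDegree d) (h2 : 2 ≤ d) {l : ℕ} (hl : 1 ≤ l)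
    (n : ℕ) (v : V) {t : ℕ} (ht : t ≤ 2 * (URT.trans l).length * URT.halfBlock d n) :
    P.urtPos l v (URT.stageStart l d n + t) = P.posAfter (URT.stage l d n) v t := by
  have h := IsLoop.posAfter_seqList (Qs := List.range (n + 1))
    (fun m _ => P.isLoop_stage hd l m v) (List.getElem?_range n.lt_succ_self) ht
  rw [List.take_range, min_eq_left n.le_succ] at h
  rw [P.urtPos_eq_posAfter_stages hd h2 hl (n + 1), URT.stageStart, Finset.mul_sum]
  · exact h
  · rw [(P.isLoop_stages hd l (n + 1) v).length_run, URT.stageStart_succ]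
    exact Nat.add_le_add_left ht _

theorem posAfter_stage_add (hd : G.IsRegularOfDegree d) {l j : ℕ} {b : Bool}
    (hj : (URT.trans l)[j]? = some b) (n : ℕ) (v : V) {t : ℕ} (ht : t ≤ 2 * URT.halfBlock d n) :
    P.posAfter (URT.stage l d n) v (2 * URT.halfBlock d n * j + t) =
      P.posAfter (URT.exec d b n) v t := by
  have h := IsLoop.posAfter_seqList (fun b _ => P.isLoop_exec hd b n v) hj ht
  have hlt := (List.getElem?_eq_some_iff.1 hj).1
  rwa [List.map_const', List.sum_replicate, List.length_take_of_le hlt.le, smul_eq_mul,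
    mul_comm] at h

theorem urtPos_of_getElem?_eq (hd : G.IsRegularOfDegree d) (h2 : 2 ≤ d) {l : ℕ} (hl : 1 ≤ l)
    {j : ℕ} {b : Bool} (hj : (URT.trans l)[j]? = some b) (n : ℕ) (v : V) {t : ℕ}
    (ht : t ≤ 2 * URT.halfBlock d n) :
    P.urtPos l v (URT.stageStart l d n + 2 * URT.halfBlock d n * j + t) =
      P.posAfter (URT.exec d b n) v t := by
  have hlt := (List.getElem?_eq_some_iff.1 hj).1
  rw [add_assoc, P.urtPos_stageStart_add hd h2 hl n v (by nlinarith),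
    P.posAfter_stage_add hd hj n v ht]

theorem urtPos_of_getElem?_eq_false (hd : G.IsRegularOfDegree d) (h2 : 2 ≤ d) {l : ℕ}
    (hl : 1 ≤ l) {j : ℕ} (hj : (URT.trans l)[j]? = some false) (n : ℕ) (v : V) {t : ℕ}
    (ht : t ≤ 2 * URT.halfBlock d n) :
    P.urtPos l v (URT.stageStart l d n + 2 * URT.halfBlock d n * j + t) = v :=
  (P.urtPos_of_getElem?_eq hd h2 hl hj n v ht).trans (P.posAfter_pass _ _ _)

theorem exists_urtPos_of_getElem?_eq_true (hG : G.Connected) (hd : G.IsRegularOfDegree d)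
    (h2 : 2 ≤ d) {l : ℕ} (hl : 1 ≤ l) {j : ℕ} (hj : (URT.trans l)[j]? = some true) {n : ℕ}
    {v u : V} (hu : G.dist v u ≤ URT.radius d n) :
    ∃ t ≤ URT.halfBlock d n,
      P.urtPos l v (URT.stageStart l d n + 2 * URT.halfBlock d n * j + t) = u ∧
      P.urtPos l v
        (URT.stageStart l d n + 2 * URT.halfBlock d n * j + (URT.halfBlock d n + t)) = u := by
  obtain ⟨t, ht, htu⟩ : ∃ t ≤ URT.halfBlock d n,
      P.posAfter (Prog.act d (URT.radius d n)) v t = u := P.exists_posAfter_act hG hd hu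
  have h_act : P.IsLoop (Prog.act d (URT.radius d n)) v (URT.halfBlock d n) := P.isLoop_act hd _ v
  refine ⟨t, ht, ?_, ?_⟩
  · rw [P.urtPos_of_getElem?_eq hd h2 hl hj n v (by omega)]
    exact (h_act.posAfter_seq_of_le ht).trans htu
  · rw [P.urtPos_of_getElem?_eq hd h2 hl hj n v (by omega)]
    exact (h_act.posAfter_seq_add t).trans htu

end PortLabeling

/-! ### Rendezvous of two timetables -/

theorem exists_le_lt_succ {α : Type*} [LinearOrder α] {f : ℕ → α} {m n : ℕ} {c : α} (hmn : m ≤ n)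
    (hm : f m ≤ c) (hn : c < f n) : ∃ k, m ≤ k ∧ k < n ∧ f k ≤ c ∧ c < f (k + 1) := by
  induction n, hmn using Nat.le_induction with
  | base => exact absurd hn hm.not_gt
  | succ n hmn ih =>
    rcases le_or_gt (f n) c with h | h
    · exact ⟨n, hmn, n.lt_succ_self, h, hn⟩
    · obtain ⟨k, hk, hkn, h⟩ := ih h
      exact ⟨k, hk, hkn.trans n.lt_succ_self, h⟩

theorem monotone_of_four_mul_le {a : ℕ → ℕ} (ha : ∀ n, 4 * a n ≤ a (n + 1)) : Monotone a :=
  monotone_nat_of_le_succ fun n => by have := ha n; omega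

/-- A word made of the pairs `01` and `10`, such as a transformed label: an agent that follows it is
active in exactly one of any two blocks of the same pair. -/
inductive IsPaired : List Bool → Prop
  | nil : IsPaired []
  | cons (c : Bool) {b : List Bool} : IsPaired b → IsPaired (c :: (!c) :: b)

namespace IsPaired

variable {b b' : List Bool}

theorem append (hb : IsPaired b) (hb' : IsPaired b') : IsPaired (b ++ b') := by
  induction hb with
  | nil => exact hb'
  | cons c _ ih => exact .cons c ih

theorem even_length (hb : IsPaired b) : Even b.length := by
  induction hb with
  | nil => exact Even.zero
  | cons _ _ ih => exact ih.add even_two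

theorem exists_getElem?_eq_true (hb : IsPaired b) {q : ℕ} (hq : 2 * q < b.length) :
    ∃ j, 2 * q ≤ j ∧ j ≤ 2 * q + 1 ∧ b[j]? = some true := by
  induction hb generalizing q with
  | nil => simp at hq
  | cons c _ ih =>
    cases q with
    | zero =>
      cases c
      · exact ⟨1, by simp⟩
      · exact ⟨0, by simp⟩
    | succ q =>
      obtain ⟨j, hj, hj', h⟩ := ih (q := q) (by simp only [List.length_cons] at hq; omega)
      exact ⟨j + 2, by omega, by omega, by simpa using h⟩

end IsPaired

/-- The words of two agents tell them apart: either they differ at some position, or one of them is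
longer than the other by so much that agents with these words lose synchrony within one stage. -/
def Separated (b b' : List Bool) : Prop :=
  (∃ (j : ℕ) (c : Bool), b[j]? = some c ∧ b'[j]? = some !c) ∨
    b.length + 4 ≤ b'.length ∨ b'.length + 4 ≤ b.length

theorem Separated.symm {b b' : List Bool} (h : Separated b b') : Separated b' b := by
  rcases h with ⟨j, c, hc, hc'⟩ | h
  · exact Or.inl ⟨j, !c, hc', by simpa using hc⟩
  · exact Or.inr h.symm

/-- The schedule of an agent that sleeps at `home` until round `S 0`, and whose stage `n` starts in
round `S n` and consists of a block of `2 * a n` rounds for each letter of the word `b`. In a block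
of the letter `0` the agent is at `home` all the time. In each half of a block of the letter `1` in
a stage `n ≥ i` it passes through `target`, at the same time after the beginning of the half. -/
structure Timetable {α : Type*} (a : ℕ → ℕ) (i : ℕ) (b : List Bool) (S : ℕ → ℕ) (home target : α)
    (pos : ℕ → α) : Prop where
  paired : IsPaired b
  head : b[0]? = some false
  start_succ : ∀ n, S (n + 1) = S n + 2 * b.length * a n
  asleep : ∀ t ≤ S 0, pos t = home
  idle : ∀ {n j : ℕ}, b[j]? = some false → ∀ t ≤ 2 * a n, pos (S n + 2 * a n * j + t) = home
  active : ∀ {n j : ℕ}, i ≤ n → b[j]? = some true → ∃ t ≤ a n,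
    pos (S n + 2 * a n * j + t) = target ∧ pos (S n + 2 * a n * j + (a n + t)) = target

namespace Timetable

variable {α : Type*} {a S S' : ℕ → ℕ} {i n : ℕ} {b b' : List Bool} {x y : α} {pos pos' : ℕ → α}

theorem two_le_length (A : Timetable a i b S x y pos) : 2 ≤ b.length := by
  obtain ⟨m, hm⟩ := A.paired.even_length
  have h_pos := (List.getElem?_eq_some_iff.1 A.head).1
  omega

theorem monotone_start (A : Timetable a i b S x y pos) : Monotone S :=
  monotone_nat_of_le_succ fun n => by rw [A.start_succ]; exact Nat.le_add_right _ _

theorem start_le (A : Timetable a i b S x y pos) (ha : ∀ n, 4 * a n ≤ a (n + 1)) (n : ℕ) :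
    S n ≤ S 0 + b.length * a n := by
  induction n with
  | zero => exact Nat.le_add_right _ _
  | succ n ih =>
    rw [A.start_succ]
    nlinarith [Nat.mul_le_mul_left b.length (ha n)]

theorem le_start_add (A : Timetable a i b S x y pos) (ha : Monotone a) (hi : 0 < a i) (m : ℕ) :
    m ≤ S (i + m) := by
  induction m with
  | zero => exact Nat.zero_le _
  | succ m ih =>
    have h_pos : 0 < b.length * a (i + m) :=
      Nat.mul_pos (two_pos.trans_le A.two_le_length) (hi.trans_le (ha (Nat.le_add_right i m)))
    rw [← add_assoc, A.start_succ, mul_assoc]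
    omega

theorem exists_target_of_pair (A : Timetable a i b S x y pos) (hn : i ≤ n) {q : ℕ}
    (hq : 2 * q < b.length) :
    ∃ t, S n + 4 * a n * q ≤ t ∧ t ≤ S n + 4 * a n * q + 4 * a n ∧ pos t = y := by
  obtain ⟨j, hj, hj', hb⟩ := A.paired.exists_getElem?_eq_true hq
  obtain ⟨t, ht, h_target, -⟩ := A.active hn hb
  refine ⟨_, ?_, ?_, h_target⟩ <;>
    nlinarith [Nat.mul_le_mul_left (a n) hj, Nat.mul_le_mul_left (a n) hj']

theorem exists_target (A : Timetable a i b S x y pos) (ha : Monotone a) (hn : i ≤ n) {T : ℕ}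
    (hT : S i ≤ T) (hT' : T + 4 * a n < S (n + 1)) : ∃ t, T ≤ t ∧ t ≤ T + 8 * a n ∧ pos t = y := by
  suffices ∃ m q, i ≤ m ∧ m ≤ n ∧ 2 * q < b.length ∧
      T ≤ S m + 4 * a m * q ∧ S m + 4 * a m * q ≤ T + 4 * a n by
    obtain ⟨m, q, him, hmn, hq, h_le, h_ge⟩ := this
    obtain ⟨t, ht, ht', h_target⟩ := A.exists_target_of_pair him hq
    have := ha hmn
    exact ⟨t, by omega, by omega, h_target⟩
  obtain ⟨m, him, hmn, hm, hm'⟩ :=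
    exists_le_lt_succ (f := S) (show i ≤ n + 1 by omega) hT (by omega)
  obtain ⟨k, hk⟩ := A.paired.even_length
  have h_end : S m + 4 * a m * k = S (m + 1) := by rw [A.start_succ, hk]; ring
  obtain ⟨q, -, hqk, hq, hq'⟩ := exists_le_lt_succ (f := fun q => S m + 4 * a m * q)
    (Nat.zero_le k) (by simpa using hm) (by simpa only [h_end] using hm')
  have h_am := ha (Nat.le_of_lt_succ hmn)
  simp only [mul_add, mul_one] at hq'
  rcases (Nat.succ_le_of_lt hqk).lt_or_eq with h_lt | h_eq
  · exact ⟨m, q + 1, him, by omega, by omega, by rw [mul_add]; omega, by rw [mul_add]; omega⟩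
  · have h_next : S (m + 1) = S m + 4 * a m * q + 4 * a m := by
      rw [← h_end, ← h_eq, Nat.succ_eq_add_one, mul_add, mul_one, add_assoc]
    have h_ne : m ≠ n := by
      rintro rfl
      omega
    have := A.two_le_length
    exact ⟨m + 1, 0, by omega, by omega, by omega, by omega, by omega⟩

/-- An agent that reaches stage `n + 1` clearly before the other one waits there, since the word
starts with `0`, long enough for the other one to be active. -/
theorem exists_meet_of_late (A : Timetable a i b S x y pos) (A' : Timetable a i b' S' y x pos')
    (ha : ∀ n, 4 * a n ≤ a (n + 1)) (hn : i ≤ n) (h_start : S' i ≤ S (n + 1))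
    (h_late : S (n + 1) + 4 * a n < S' (n + 1)) :
    ∃ t ≤ S (n + 1) + 8 * a n, pos t = pos' t := by
  have h_mono := monotone_of_four_mul_le ha
  obtain ⟨t, ht, ht', h_target⟩ := A'.exists_target h_mono hn h_start h_late
  obtain ⟨s, rfl⟩ := Nat.exists_eq_add_of_le ht
  have h_idle := A.idle (n := n + 1) A.head s (by have := ha n; omega)
  exact ⟨_, ht', h_idle.trans h_target.symm⟩

theorem exists_meet_of_ne (A : Timetable a i b S x y pos) (A' : Timetable a i b' S' y x pos')
    (hn : i ≤ n) (h_le : S n ≤ S' n) (h_near : S' n ≤ S n + a n) {j : ℕ} {c : Bool}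
    (hc : b[j]? = some c) (hc' : b'[j]? = some !c) :
    ∃ t ≤ S n + 2 * a n * (j + 1), pos t = pos' t := by
  obtain ⟨δ, hδ⟩ := Nat.exists_eq_add_of_le h_le
  rw [mul_add, mul_one]
  cases c with
  | true =>
    -- the second half of the active block lies within the idle block that starts up to `a n` later
    obtain ⟨t, ht, -, h_target⟩ := A.active hn hc
    have h_idle := A'.idle (n := n) hc' (a n + t - δ) (by omega)
    refine ⟨_, by omega, h_target.trans ?_⟩
    rw [← h_idle]
    congr 1
    omega
  | false =>
    obtain ⟨t, ht, h_target, -⟩ := A'.active hn hc'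
    have h_idle := A.idle (n := n) hc (δ + t) (by omega)
    refine ⟨_, by omega, h_idle.trans ?_⟩
    rw [← h_target]
    congr 1
    omega

theorem exists_meet_of_near (A : Timetable a i b S x y pos) (A' : Timetable a i b' S' y x pos')
    (ha : ∀ n, 4 * a n ≤ a (n + 1)) (hi : 0 < a n) (h_sep : Separated b b') (hn : i ≤ n)
    (h_le : S n ≤ S' n) (h_near : S' n ≤ S n + a n) :
    ∃ t ≤ min (S (n + 1)) (S' (n + 1)) + 8 * a n, pos t = pos' t := by
  have h_S := A.start_succ n
  have h_S' := A'.start_succ n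
  rcases h_sep with ⟨j, c, hc, hc'⟩ | h_len | h_len
  · obtain ⟨t, ht, h_meet⟩ := A.exists_meet_of_ne A' hn h_le h_near hc hc'
    have hj := Nat.mul_le_mul_left (a n) (List.getElem?_eq_some_iff.1 hc).1
    have hj' := Nat.mul_le_mul_left (a n) (List.getElem?_eq_some_iff.1 hc').1
    refine ⟨t, ?_, h_meet⟩
    rw [min_add, le_min_iff]
    constructor <;> nlinarith
  · have h_late : S (n + 1) + 4 * a n < S' (n + 1) := by nlinarith
    rw [min_eq_left (by omega)]
    exact A.exists_meet_of_late A' ha hn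
      ((A'.monotone_start hn).trans (by nlinarith [A.two_le_length])) h_late
  · have h_late : S' (n + 1) + 4 * a n < S (n + 1) := by nlinarith
    rw [min_eq_right (by omega)]
    obtain ⟨t, ht, h_meet⟩ := A'.exists_meet_of_late A ha hn
      ((A.monotone_start hn).trans (h_le.trans (A'.monotone_start n.le_succ))) h_late
    exact ⟨t, ht, h_meet.symm⟩

theorem exists_meet (A : Timetable a i b S x y pos) (A' : Timetable a i b' S' y x pos')
    (ha : ∀ n, 4 * a n ≤ a (n + 1)) (hi : 0 < a i) (h_sep : Separated b b') (hn : i ≤ n)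
    (h_start : S i ≤ S' (n + 1)) (h_start' : S' i ≤ S (n + 1)) :
    ∃ t ≤ min (S (n + 2)) (S' (n + 2)) + 8 * a (n + 1), pos t = pos' t := by
  wlog h_le : S (n + 1) ≤ S' (n + 1) generalizing b b' S S' x y pos pos'
  · obtain ⟨t, ht, h_meet⟩ := this A' A h_sep.symm h_start' h_start (le_of_not_ge h_le)
    exact ⟨t, by rwa [min_comm], h_meet.symm⟩
  have h_mono := monotone_of_four_mul_le ha
  rcases lt_or_ge (S (n + 1) + 4 * a n) (S' (n + 1)) with h_late | h_near
  · obtain ⟨t, ht, h_meet⟩ := A.exists_meet_of_late A' ha hn h_start' h_late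
    have h_min := le_min (A.monotone_start (n + 1).le_succ)
      (h_le.trans (A'.monotone_start (n + 1).le_succ))
    exact ⟨t, ht.trans (Nat.add_le_add h_min (by have := ha n; omega)), h_meet⟩
  · exact A.exists_meet_of_near A' ha (hi.trans_le (h_mono (by omega))) h_sep (by omega) h_le
      (h_near.trans (Nat.add_le_add_left (ha n) _))

/-- A stage that starts early enough has a short predecessor and is at most `R` times as long; hence
it and the next stage are over soon. -/
theorem start_add_two_le (A : Timetable a i b S x y pos) {R K c : ℕ} (hR : 0 < R)
    (h_succ : ∀ n, i ≤ n → a (n + 1) ≤ R * a n) (hK : b.length ≤ K) (hn : i ≤ n) (hc : c ≤ S 0)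
    (h_start : S n ≤ c + 4 * (K * a i)) :
    S (n + 2) + 8 * a (n + 1) ≤ c + 20 * R ^ 2 * (K * a i) := by
  have h_stage : b.length * a n ≤ 2 * R * (K * a i) := by
    rcases hn.eq_or_lt with rfl | h_lt
    · calc b.length * a i ≤ 1 * (K * a i) := by rw [one_mul]; exact Nat.mul_le_mul_right _ hK
        _ ≤ 2 * R * (K * a i) := Nat.mul_le_mul_right _ (by omega)
    · obtain ⟨m, rfl⟩ := Nat.exists_eq_add_one_of_ne_zero h_lt.ne_bot
      have h_prev : b.length * a m ≤ 2 * (K * a i) := by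
        have := A.start_succ m
        have := A.monotone_start (Nat.zero_le m)
        rw [mul_assoc] at *
        omega
      calc b.length * a (m + 1) ≤ b.length * (R * a m) :=
            Nat.mul_le_mul_left _ (h_succ m (Nat.le_of_lt_succ h_lt))
        _ = R * (b.length * a m) := by ring
        _ ≤ R * (2 * (K * a i)) := Nat.mul_le_mul_left _ h_prev
        _ = 2 * R * (K * a i) := by ring
  have h_next : b.length * a (n + 1) ≤ 2 * R ^ 2 * (K * a i) :=
    calc b.length * a (n + 1) ≤ b.length * (R * a n) := Nat.mul_le_mul_left _ (h_succ n hn)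
      _ = R * (b.length * a n) := by ring
      _ ≤ R * (2 * R * (K * a i)) := Nat.mul_le_mul_left _ h_stage
      _ = 2 * R ^ 2 * (K * a i) := by ring
  have h_two : 2 * a (n + 1) ≤ b.length * a (n + 1) := Nat.mul_le_mul_right _ A.two_le_length
  have h_sq : R * (K * a i) ≤ R ^ 2 * (K * a i) :=
    Nat.mul_le_mul_right _ (Nat.le_self_pow two_ne_zero R)
  have h_one : K * a i ≤ R * (K * a i) := Nat.le_mul_of_pos_left _ hR
  rw [A.start_succ (n + 1), A.start_succ n]
  nlinarith

theorem exists_meet_of_start_zero_le (A : Timetable a i b S x y pos)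
    (A' : Timetable a i b' S' y x pos') (ha : ∀ n, 4 * a n ≤ a (n + 1)) (hi : 0 < a i) {R K : ℕ}
    (h_succ : ∀ n, i ≤ n → a (n + 1) ≤ R * a n) (hK : b.length ≤ K) (hK' : b'.length ≤ K)
    (h_sep : Separated b b') (h_le : S 0 ≤ S' 0) :
    ∃ t ≤ S 0 + 20 * R ^ 2 * (K * a i), pos t = pos' t := by
  have h_mono := monotone_of_four_mul_le ha
  have hR : 0 < R := by
    have := ha i
    have := h_succ i le_rfl
    exact Nat.pos_of_mul_pos_right (by omega : 0 < R * a i)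
  have h_Si : S i ≤ S 0 + K * a i :=
    (A.start_le ha i).trans (Nat.add_le_add_left (Nat.mul_le_mul_right _ hK) _)
  have h_two : 2 * a i ≤ b.length * a i := Nat.mul_le_mul_right _ A.two_le_length
  have h_K : b.length * a i ≤ K * a i := Nat.mul_le_mul_right _ hK
  have h_stage := A.start_succ i
  rw [mul_assoc] at h_stage
  rcases le_or_gt (S (i + 1)) (S' 0) with h_asleep | h_awake
  · obtain ⟨t, -, ht, h_target⟩ := A.exists_target_of_pair le_rfl
      (q := 0) (two_pos.trans_le A.two_le_length)
    refine ⟨t, ?_, h_target.trans (A'.asleep t (by omega)).symm⟩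
    nlinarith [Nat.one_le_pow 2 R hR]
  · have h_S'i : S' i ≤ S' 0 + K * a i :=
      (A'.start_le ha i).trans (Nat.add_le_add_left (Nat.mul_le_mul_right _ hK') _)
    set T := max (S i) (S' i)
    obtain ⟨n, hn, -, h_before, h_after⟩ := exists_le_lt_succ (f := fun n => min (S n) (S' n))
      (Nat.le_add_right i (T + 1)) (min_le_max : _ ≤ T)
      (lt_min (A.le_start_add h_mono hi _) (A'.le_start_add h_mono hi _))
    obtain ⟨t, ht, h_meet⟩ := A.exists_meet A' ha hi h_sep hn
      (by omega) (by omega)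
    refine ⟨t, ht.trans ?_, h_meet⟩
    rcases min_le_iff.1 h_before with h | h
    · have := A.start_add_two_le hR h_succ hK hn le_rfl (h.trans (by omega))
      omega
    · have := A'.start_add_two_le hR h_succ hK' hn h_le (h.trans (by omega))
      omega

theorem exists_meet_within (A : Timetable a i b S x y pos) (A' : Timetable a i b' S' y x pos')
    (ha : ∀ n, 4 * a n ≤ a (n + 1)) (hi : 0 < a i) {R K : ℕ}
    (h_succ : ∀ n, i ≤ n → a (n + 1) ≤ R * a n) (hK : b.length ≤ K) (hK' : b'.length ≤ K)
    (h_sep : Separated b b') :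
    ∃ τ ≤ 20 * R ^ 2 * (K * a i), pos (min (S 0) (S' 0) + τ) = pos' (min (S 0) (S' 0) + τ) := by
  obtain ⟨t, ht, h_meet⟩ : ∃ t ≤ min (S 0) (S' 0) + 20 * R ^ 2 * (K * a i), pos t = pos' t := by
    rcases le_total (S 0) (S' 0) with h | h
    · rw [min_eq_left h]
      exact A.exists_meet_of_start_zero_le A' ha hi h_succ hK hK' h_sep h
    · rw [min_eq_right h]
      obtain ⟨t, ht, h_meet⟩ :=
        A'.exists_meet_of_start_zero_le A ha hi h_succ hK' hK h_sep.symm h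
      exact ⟨t, ht, h_meet.symm⟩
  rcases le_total (min (S 0) (S' 0)) t with h | h
  · exact ⟨t - min (S 0) (S' 0), by omega, by rwa [Nat.add_sub_cancel' h]⟩
  · refine ⟨0, Nat.zero_le _, ?_⟩
    rw [add_zero, A.asleep _ (min_le_left _ _), A'.asleep _ (min_le_right _ _),
      ← A.asleep t (by omega), h_meet, A'.asleep t (by omega)]

end Timetable

namespace URT

/-! ### Transformed labels -/

/-- The word that replaces a bit of the label. -/
def code (c : Bool) : List Bool :=
  if c then [false, true, false, true, false, true] else [true, false, true, false, true, false]

theorem trans_eq_flatMap_code (l : ℕ) : trans l = l.bits.reverse.flatMap code := rfl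

theorem length_code (c : Bool) : (code c).length = 6 := by cases c <;> rfl

theorem code_injective : Function.Injective code := by decide

theorem isPaired_code (c : Bool) : IsPaired (code c) := by
  cases c
  · exact .cons true (.cons true (.cons true .nil))
  · exact .cons false (.cons false (.cons false .nil))

theorem length_trans (l : ℕ) : (trans l).length = 6 * l.size := by
  rw [trans_eq_flatMap_code, List.length_flatMap, funext length_code, List.map_const',
    List.sum_replicate, List.length_reverse, Nat.size_eq_bits_len, smul_eq_mul, mul_comm]

theorem isPaired_trans (l : ℕ) : IsPaired (trans l) := by
  rw [trans_eq_flatMap_code]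
  induction l.bits.reverse with
  | nil => exact .nil
  | cons c s ih => exact (isPaired_code c).append ih

theorem getLast?_bits {l : ℕ} (hl : 1 ≤ l) : l.bits.getLast? = some true := by
  induction l using Nat.binaryRec' with
  | zero => omega
  | bit c n h ih =>
    rw [Nat.bits_append_bit n c h, List.getLast?_cons]
    rcases Nat.eq_zero_or_pos n with rfl | hn
    · simpa using h rfl
    · rw [ih hn, Option.getD_some]

theorem getElem?_zero_trans {l : ℕ} (hl : 1 ≤ l) : (trans l)[0]? = some false := by
  obtain ⟨s, hs⟩ := List.head?_eq_some_iff.1 (List.head?_reverse.trans (getLast?_bits hl))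
  rw [trans_eq_flatMap_code, hs]
  rfl

theorem flatMap_code_injective : Function.Injective fun s : List Bool => s.flatMap code := by
  intro s
  induction s with
  | nil =>
    rintro (_ | ⟨c, s'⟩) h
    · rfl
    · cases c <;> simp [code] at h
  | cons c s ih =>
    rintro (_ | ⟨c', s'⟩) h
    · cases c <;> simp [code] at h
    · simp only [List.flatMap_cons] at h
      obtain ⟨h_code, h_rest⟩ := List.append_inj h (by rw [length_code, length_code])
      rw [code_injective h_code, ih h_rest]

theorem trans_injective : Function.Injective trans := fun l l' h => by
  have h_bits := List.reverse_injective (flatMap_code_injective h)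
  exact Nat.eq_of_testBit_eq fun i => by rw [Nat.testBit_eq_inth, Nat.testBit_eq_inth, h_bits]

theorem separated_trans {l l' : ℕ} (h : l ≠ l') : Separated (trans l) (trans l') := by
  by_cases h_len : (trans l).length = (trans l').length
  · obtain ⟨j, hj, hj', h_ne⟩ : ∃ (j : ℕ) (hj : j < (trans l).length)
        (hj' : j < (trans l').length), (trans l)[j] ≠ (trans l')[j] := by
      by_contra! h_eq
      exact h (trans_injective (List.ext_getElem h_len h_eq))
    refine Or.inl ⟨j, _, List.getElem?_eq_getElem hj, ?_⟩
    rw [List.getElem?_eq_getElem hj', Bool.eq_not.2 h_ne.symm]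
  · rw [length_trans, length_trans] at h_len
    rw [Separated, length_trans, length_trans]
    omega

theorem size_le_log {L : ℕ} (hL : 2 ≤ L) : (L.size : ℝ) ≤ 2 / Real.log 2 * Real.log L := by
  have h_size : (2 : ℝ) ^ (L.size - 1) ≤ L := by
    have := Nat.lt_size.1 (Nat.pred_lt_self (Nat.size_pos.2 (by omega : 0 < L)))
    exact_mod_cast this
  have h_log := Real.log_le_log (by positivity) h_size
  have h_log_two : Real.log 2 ≤ Real.log L := Real.log_le_log two_pos (by exact_mod_cast hL)
  rw [Real.log_pow, Nat.cast_sub (Nat.size_pos.2 (by omega)), Nat.cast_one] at h_log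
  rw [div_mul_eq_mul_div, le_div_iff₀ (Real.log_pos one_lt_two)]
  linarith

/-! ### Lengths of the explorations -/

theorem a_le_two_mul_z (d r : ℕ) : a d r ≤ 2 * z d r := Nat.mul_le_mul_left _ (Nat.sub_le _ _)

theorem a_mono (d : ℕ) : Monotone (a d) := by
  refine monotone_nat_of_le_succ fun r => ?_
  simp only [a, z, Finset.sum_range_succ]
  omega

theorem two_mul_le_a (d : ℕ) {r : ℕ} (hr : 1 ≤ r) : 2 * d ≤ a d r :=
  calc 2 * d = a d 1 := by simp [a, z]
    _ ≤ a d r := a_mono d hr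

theorem a_two (r : ℕ) : a 2 r = 4 * r := by
  rw [a_eq_mul_branchLength, Prog.branchLength]
  norm_num
  ring

theorem a_succ {d : ℕ} (hd : 1 ≤ d) (r : ℕ) : a d (r + 1) + a d r = d * a d r + 2 * d := by
  obtain ⟨e, rfl⟩ := Nat.exists_eq_add_of_le' hd
  simp only [a_eq_mul_branchLength, Prog.branchLength_succ, Nat.add_sub_cancel]
  ring

theorem a_succ_le {d r : ℕ} (hd : 1 ≤ d) (hr : 1 ≤ r) : a d (r + 1) ≤ d * a d r := by
  have := a_succ hd r
  have := two_mul_le_a d hr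
  omega

theorem two_mul_a_le {d : ℕ} (hd : 3 ≤ d) (r : ℕ) : 2 * a d r ≤ a d (r + 1) := by
  have := a_succ (by omega : 1 ≤ d) r
  have := Nat.mul_le_mul_right (a d r) hd
  omega

theorem radius_two (n : ℕ) : radius 2 n = 4 ^ n := by
  rw [radius, if_pos rfl, pow_mul]
  norm_num

theorem radius_of_three_le {d : ℕ} (hd : 3 ≤ d) (n : ℕ) : radius d n = 2 * n :=
  if_neg (by omega)

theorem radius_mono (d : ℕ) : Monotone (radius d) := fun m n h => by
  unfold radius
  split_ifs
  · exact Nat.pow_le_pow_right two_pos (Nat.mul_le_mul_left 2 h)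
  · exact Nat.mul_le_mul_left 2 h

theorem four_mul_halfBlock_le {d : ℕ} (hd : 2 ≤ d) (n : ℕ) :
    4 * halfBlock d n ≤ halfBlock d (n + 1) := by
  rcases hd.eq_or_lt with rfl | h3
  · simp only [halfBlock, a_two, radius_two, pow_succ]
    omega
  · rw [halfBlock, halfBlock, radius_of_three_le h3, radius_of_three_le h3,
      show 2 * (n + 1) = 2 * n + 1 + 1 by ring]
    have := two_mul_a_le h3 (2 * n)
    have := two_mul_a_le h3 (2 * n + 1)
    omega

theorem halfBlock_succ_le {d n : ℕ} (hd : 2 ≤ d) (hn : 1 ≤ radius d n) :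
    halfBlock d (n + 1) ≤ d ^ 2 * halfBlock d n := by
  rcases hd.eq_or_lt with rfl | h3
  · simp only [halfBlock, a_two, radius_two, pow_succ]
    omega
  · rw [radius_of_three_le h3] at hn
    rw [halfBlock, halfBlock, radius_of_three_le h3, radius_of_three_le h3, mul_add_one, pow_two,
      mul_assoc]
    exact (a_succ_le (by omega) (by omega)).trans
      (Nat.mul_le_mul_left d (a_succ_le (by omega) hn))

theorem exists_le_radius {d D : ℕ} (hd : 2 ≤ d) (hD : 1 ≤ D) :
    ∃ n, D ≤ radius d n ∧ halfBlock d n ≤ d ^ 2 * a d D := by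
  rcases hd.eq_or_lt with rfl | h3
  · refine ⟨Nat.log 4 D + 1, ?_, ?_⟩
    · rw [radius_two]
      exact (Nat.lt_pow_succ_log_self (by norm_num) D).le
    · have := Nat.pow_log_le_self 4 (by omega : D ≠ 0)
      rw [halfBlock, a_two, a_two, radius_two, pow_succ]
      omega
  · refine ⟨(D + 1) / 2, ?_, ?_⟩
    · rw [radius_of_three_le h3]
      omega
    · calc halfBlock d ((D + 1) / 2) ≤ a d (D + 1) := by
            rw [halfBlock, radius_of_three_le h3]
            exact a_mono d (by omega)
        _ ≤ d * a d D := a_succ_le (by omega) hD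
        _ ≤ d ^ 2 * a d D := Nat.mul_le_mul_right _ (Nat.le_self_pow two_ne_zero d)

end URT

/-! ### Rendezvous of two agents -/

namespace PortLabeling

variable {V : Type u} {G : SimpleGraph V} [G.LocallyFinite] (P : PortLabeling G) {d : ℕ}

theorem timetable_urtPosAt (hG : G.Connected) (hd : G.IsRegularOfDegree d) (h2 : 2 ≤ d) {l : ℕ}
    (hl : 1 ≤ l) {v u : V} {i : ℕ} (hu : G.dist v u ≤ URT.radius d i) (w : ℕ) :
    Timetable (URT.halfBlock d) i (URT.trans l) (fun n => w + URT.stageStart l d n) v u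
      (P.urtPosAt l v w) where
  paired := URT.isPaired_trans l
  head := URT.getElem?_zero_trans hl
  start_succ n := by rw [URT.stageStart_succ, add_assoc]
  asleep t ht := by
    have h_le : t ≤ w := by simpa [URT.stageStart] using ht
    rw [urtPosAt, Nat.sub_eq_zero_of_le h_le]
    rfl
  idle {n j} hj t ht := by
    rw [urtPosAt, add_assoc w, add_assoc w, Nat.add_sub_cancel_left]
    exact P.urtPos_of_getElem?_eq_false hd h2 hl hj n v ht
  active {n j} hn hj := by
    simp only [urtPosAt, add_assoc w, Nat.add_sub_cancel_left]
    exact P.exists_urtPos_of_getElem?_eq_true hG hd h2 hl hj (hu.trans (URT.radius_mono d hn))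

theorem exists_togetherAt_le (hG : G.Connected) (hd : G.IsRegularOfDegree d) (h2 : 2 ≤ d)
    {L l₁ l₂ : ℕ} (hl₁ : l₁ ∈ Finset.Icc 1 L) (hl₂ : l₂ ∈ Finset.Icc 1 L) (hne : l₁ ≠ l₂)
    (v₁ v₂ : V) (w₁ w₂ : ℕ) :
    ∃ τ ≤ 240 * d ^ 6 * (URT.z d (G.dist v₁ v₂) * L.size),
      P.TogetherAt l₁ l₂ v₁ v₂ w₁ w₂ τ := by
  rw [Finset.mem_Icc] at hl₁ hl₂
  rcases Nat.eq_zero_or_pos (G.dist v₁ v₂) with h0 | hD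
  · obtain rfl := hG.dist_eq_zero_iff.1 h0
    refine ⟨0, Nat.zero_le _, ?_⟩
    rw [TogetherAt, urtPosAt, urtPosAt, add_zero, Nat.sub_eq_zero_of_le (min_le_left _ _),
      Nat.sub_eq_zero_of_le (min_le_right _ _)]
    rfl
  obtain ⟨i, hi, h_halfBlock⟩ := URT.exists_le_radius h2 hD
  have h_radius : ∀ n, i ≤ n → 1 ≤ URT.radius d n := fun n hn =>
    hD.trans_le (hi.trans (URT.radius_mono d hn))
  have h_pos : 0 < URT.halfBlock d i :=
    (by omega : 0 < 2 * d).trans_le (URT.two_mul_le_a d (h_radius i le_rfl))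
  have h_length : ∀ l ≤ L, (URT.trans l).length ≤ 6 * L.size := fun l hl => by
    rw [URT.length_trans]
    exact Nat.mul_le_mul_left 6 (Nat.size_le_size hl)
  obtain ⟨τ, hτ, h_meet⟩ :=
    (P.timetable_urtPosAt hG hd h2 hl₁.1 hi w₁).exists_meet_within
      (P.timetable_urtPosAt hG hd h2 hl₂.1 (G.dist_comm.trans_le hi) w₂)
      (URT.four_mul_halfBlock_le h2) h_pos (fun n hn => URT.halfBlock_succ_le h2 (h_radius n hn))
      (h_length l₁ hl₁.2) (h_length l₂ hl₂.2) (URT.separated_trans hne)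
  refine ⟨τ, hτ.trans ?_, h_meet⟩
  calc 20 * (d ^ 2) ^ 2 * (6 * L.size * URT.halfBlock d i)
      ≤ 20 * (d ^ 2) ^ 2 * (6 * L.size * (d ^ 2 * (2 * URT.z d (G.dist v₁ v₂)))) := by
        gcongr
        exact h_halfBlock.trans (Nat.mul_le_mul_left _ (URT.a_le_two_mul_z d _))
    _ = 240 * d ^ 6 * (URT.z d (G.dist v₁ v₂) * L.size) := by ring

end PortLabeling

theorem mainTheorem1_general (d : ℕ) (hd : 2 ≤ d) :
    ∃ C : ℝ, ∀ (V : Type u) (G : SimpleGraph V) [G.LocallyFinite] (P : PortLabeling G),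
      G.Connected → G.IsRegularOfDegree d →
      ∀ L l₁ l₂ : ℕ, l₁ ∈ Finset.Icc 1 L → l₂ ∈ Finset.Icc 1 L → l₁ ≠ l₂ →
      ∀ (v₁ v₂ : V) (w₁ w₂ : ℕ),
        ∃ τ : ℕ, IsLeast {τ : ℕ | P.TogetherAt l₁ l₂ v₁ v₂ w₁ w₂ τ} τ ∧
          (τ : ℝ) ≤ C * (URT.z d (G.dist v₁ v₂) : ℝ) * Real.log (L : ℝ) := by
  refine ⟨240 * d ^ 6 * (2 / Real.log 2), ?_⟩
  intro V G _ P hG hreg L l₁ l₂ hl₁ hl₂ hne v₁ v₂ w₁ w₂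
  obtain ⟨σ, hσ, h_meet⟩ := P.exists_togetherAt_le hG hreg hd hl₁ hl₂ hne v₁ v₂ w₁ w₂
  obtain ⟨τ, hτ⟩ : ∃ τ, IsLeast {τ | P.TogetherAt l₁ l₂ v₁ v₂ w₁ w₂ τ} τ :=
    ⟨_, isLeast_csInf ⟨σ, h_meet⟩⟩
  refine ⟨τ, hτ, ?_⟩
  have hL : 2 ≤ L := by
    rw [Finset.mem_Icc] at hl₁ hl₂
    omega
  calc (τ : ℝ) ≤ (240 * d ^ 6 * (URT.z d (G.dist v₁ v₂) * L.size) : ℕ) := by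
        exact_mod_cast (hτ.2 h_meet).trans hσ
    _ = 240 * d ^ 6 * (URT.z d (G.dist v₁ v₂) * (L.size : ℝ)) := by push_cast; rfl
    _ ≤ 240 * d ^ 6 * (URT.z d (G.dist v₁ v₂) * (2 / Real.log 2 * Real.log L)) := by
        gcongr
        exact URT.size_le_log hL
    _ = 240 * d ^ 6 * (2 / Real.log 2) * URT.z d (G.dist v₁ v₂) * Real.log L := by ring

theorem mainTheorem1 (d : ℕ) (hd : 2 ≤ d) :
    ∃ C : ℝ, ∀ (V : Type u) (G : SimpleGraph V) [G.LocallyFinite] (P : PortLabeling G),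
      G.IsTree → G.IsRegularOfDegree d →
      ∀ L l₁ l₂ : ℕ, l₁ ∈ Finset.Icc 1 L → l₂ ∈ Finset.Icc 1 L → l₁ ≠ l₂ →
      ∀ (D : ℕ) (v₁ v₂ : V), G.dist v₁ v₂ = D →
      ∀ w₁ w₂ : ℕ,
        ∃ τ : ℕ, IsLeast {τ : ℕ | P.TogetherAt l₁ l₂ v₁ v₂ w₁ w₂ τ} τ ∧
          ∀ x : V, (τ : ℝ) ≤ C * (ballSize G x D : ℝ) * Real.log (L : ℝ) := by
  obtain ⟨C, hC⟩ := mainTheorem1_general.{u} d hd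
  refine ⟨C, fun V G _ P hG hreg L l₁ l₂ hl₁ hl₂ hne D v₁ v₂ hD w₁ w₂ => ?_⟩
  obtain ⟨τ, hτ, hle⟩ := hC V G P hG.connected hreg L l₁ l₂ hl₁ hl₂ hne v₁ v₂ w₁ w₂
  exact ⟨τ, hτ, fun x => by rwa [ballSize_eq_z hG hreg, ← hD]⟩
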